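/- Let $C$ be an integral domain of characteristic zero and let $\lambda\in C$. For a commutative unital $C$-algebra $A$, let $Ш_C(A)=Ш_{C,\lambda}(A)=\bigoplus_{k\ge 0}A^{\otimes_C (k+1)}=A\otimes_C\bigoplus_{k\ge 0}A^{\otimes_C k}$ be the free (shuffle) Baxter $C$-algebra of weight $\lambda$ on $A$, with the product $(x_0\otimes x^+)(y_0\otimes y^+)=x_0y_0\otimes(x^+\star y^+)$. Here $\star$ is the mixable shuffle product of weight $\lambda$: the $C$-bilinear product on $\bigoplus_{k\ge0}A^{\otimes k}$ with unit $1\in A^{\otimes 0}=C$ and $$(a\otimes s)\star(b\otimes t)=a\otimes\bigl(s\star(b\otimes t)\bigr)+b\otimes\bigl((a\otimes s)\star t\bigr)+\lambda\,ab\otimes(s\star t).$$ For a set $X$ put $Ш_C(X)=Ш_C(C[X])$, where $C[X]$ is the polynomial algebra on $X$. 1. If $A$ is a $C$-algebra that is an integral domain and is flat as a $C$-module, then $Ш_C(A)$ is an integral domain. In particular, $Ш_C(X)$ is an integral domain for every set $X$. 2. Suppose that $C$ is a Dedekind domain, and let $A$ be a commutative $C$-algebra whose structure map $C\to A$ is injective.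 Then $Ш_C(A)$ is an integral domain if and only if $A$ is an integral domain and is torsion-free as a $C$-module. -/

import Mathlib

open scoped TensorProduct

namespace ShuffleBaxter

noncomputable section

section Product

variable {C : Type*} [CommRing C] {A : Type*} [CommRing A] [Algebra C A]

/-- Prepending a tensor factor, `a, t ↦ a ⊗ t`, on `T(A) = ⨁ₙ A^{⊗ n}`. -/
def cons : A →ₗ[C] TensorAlgebra C A →ₗ[C] TensorAlgebra C A :=
  (LinearMap.mul C (TensorAlgebra C A)).comp (TensorAlgebra.ι C)

theorem cons_apply (a : A) (t : TensorAlgebra C A) :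
    cons a t = TensorAlgebra.ι C a * t := rfl

theorem word_induction {p : TensorAlgebra C A → Prop} (one : p 1)
    (add : ∀ s t, p s → p t → p (s + t)) (smul : ∀ (c : C) t, p t → p (c • t))
    (hcons : ∀ a t, p t → p (cons a t)) (t : TensorAlgebra C A) : p t := by
  suffices h : ∀ s t : TensorAlgebra C A, p t → p (s * t) by simpa using h t 1 one
  intro s
  induction s using TensorAlgebra.induction with
  | algebraMap r => intro t ht; rw [← Algebra.smul_def]; exact smul r t ht
  | ι a => intro t ht; exact hcons a t ht
  | mul x y hx hy => intro t ht; rw [mul_assoc]; exact hx _ (hy _ ht)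
  | add x y hx hy => intro t ht; rw [add_mul]; exact add _ _ (hx _ ht) (hy _ ht)

theorem linearMap_ext {M : Type*} [AddCommGroup M] [Module C M]
    {f g : TensorAlgebra C A →ₗ[C] M} (one : f 1 = g 1)
    (hcons : ∀ a t, f t = g t → f (cons a t) = g (cons a t)) : f = g := by
  ext t
  induction t using word_induction with
  | one => exact one
  | add s t hs ht => rw [map_add, map_add, hs, ht]
  | smul c t ht => rw [map_smul, map_smul, ht]
  | hcons a t ht => exact hcons a t ht

/-- Auxiliary: one step `(t, g) ↦ (b ⊗ t, b ⊗ g + a ⊗ f(b ⊗ t) + lam (ab ⊗ f(t)))`. -/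
def stepAux (lam : C) (a : A) (f : Module.End C (TensorAlgebra C A)) :
    A →ₗ[C] Module.End C (TensorAlgebra C A × TensorAlgebra C A) where
  toFun b := LinearMap.prod ((cons b).comp (LinearMap.fst C _ _))
    ((cons b).comp (LinearMap.snd C _ _) +
      ((cons a).comp (f.comp (cons b)) + lam • (cons (a * b)).comp f).comp (LinearMap.fst C _ _))
  map_add' b c := by
    ext x <;> simp [mul_add, map_add, smul_add]
    abel
  map_smul' r b := by
    ext x <;> simp [smul_add, smul_comm lam r]

theorem stepAux_apply (lam : C) (a : A) (f : Module.End C (TensorAlgebra C A)) (b : A)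
    (p : TensorAlgebra C A × TensorAlgebra C A) :
    stepAux lam a f b p =
      (cons b p.1, cons b p.2 + (cons a (f (cons b p.1)) + lam • cons (a * b) (f p.1))) := rfl

/-- Auxiliary: the endomorphism `g` with `g(1) = a ⊗ f(1)` and
`g(b ⊗ t) = a ⊗ f(b ⊗ t) + b ⊗ g(t) + lam (ab ⊗ f(t))`. -/
def stepFun (lam : C) (a : A) (f : Module.End C (TensorAlgebra C A)) :
    Module.End C (TensorAlgebra C A) :=
  (LinearMap.snd C _ _).comp
    ((LinearMap.applyₗ ((1 : TensorAlgebra C A), cons a (f 1))).comp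
      (TensorAlgebra.lift C (stepAux lam a f)).toLinearMap)

theorem stepFun_one (lam : C) (a : A) (f : Module.End C (TensorAlgebra C A)) :
    stepFun lam a f 1 = cons a (f 1) := by
  simp [stepFun]

theorem stepFun_cons (lam : C) (a : A) (f : Module.End C (TensorAlgebra C A)) (b : A)
    (t : TensorAlgebra C A) :
    stepFun lam a f (cons b t) =
      cons a (f (cons b t)) + cons b (stepFun lam a f t) + lam • cons (a * b) (f t) := by
  have key : ∀ t : TensorAlgebra C A,
      (TensorAlgebra.lift C (stepAux lam a f) t ((1 : TensorAlgebra C A), cons a (f 1))).1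
        = t := by
    intro t
    induction t using word_induction with
    | one => simp
    | add s t hs ht => simp [map_add, hs, ht]
    | smul c t ht => simp [ht]
    | hcons b t ht =>
      rw [cons_apply, map_mul, Module.End.mul_apply, TensorAlgebra.lift_ι_apply, stepAux_apply,
        ht, cons_apply]
  simp only [stepFun, LinearMap.comp_apply, AlgHom.toLinearMap_apply, LinearMap.applyₗ_apply_apply,
    LinearMap.snd_apply]
  rw [cons_apply b t, map_mul, Module.End.mul_apply, TensorAlgebra.lift_ι_apply, stepAux_apply,
    key, ← cons_apply b t, ← add_assoc, add_comm (cons b _)]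

/-- Left multiplication by `a ⊗ s` in terms of left multiplication `f` by `s`. -/
def step (lam : C) : A →ₗ[C] Module.End C (Module.End C (TensorAlgebra C A)) where
  toFun a :=
    { toFun := stepFun lam a
      map_add' := fun f g => by
        refine linearMap_ext ?_ fun b t h => ?_
        · simp [stepFun_one]
        · simp only [LinearMap.add_apply, stepFun_cons] at h ⊢
          rw [h]; simp only [map_add, smul_add]; abel
      map_smul' := fun r f => by
        refine linearMap_ext ?_ fun b t h => ?_
        · simp [stepFun_one]
        · simp only [LinearMap.smul_apply, stepFun_cons, RingHom.id_apply] at h ⊢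
          rw [h]; simp only [map_smul, smul_add, smul_comm lam r] }
  map_add' a a' := by
    ext1 f
    refine linearMap_ext ?_ fun b t h => ?_
    · simp [stepFun_one]
    · simp only [LinearMap.add_apply, stepFun_cons, LinearMap.coe_mk, AddHom.coe_mk] at h ⊢
      rw [h]; simp only [map_add, smul_add, add_mul, LinearMap.add_apply]; abel
  map_smul' r a := by
    ext1 f
    refine linearMap_ext ?_ fun b t h => ?_
    · simp [stepFun_one]
    · simp only [LinearMap.smul_apply, stepFun_cons, RingHom.id_apply, LinearMap.coe_mk,
        AddHom.coe_mk] at h ⊢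
      rw [h]; simp only [map_smul, smul_add, smul_comm lam r, LinearMap.smul_apply,
        smul_mul_assoc]

/-- The mixable shuffle product of weight `lam` on `T(A) = ⨁ₙ A^{⊗ n}`. -/
def mixMul (lam : C) : TensorAlgebra C A →ₗ[C] TensorAlgebra C A →ₗ[C] TensorAlgebra C A :=
  (LinearMap.applyₗ (LinearMap.id : Module.End C (TensorAlgebra C A))).comp
    (TensorAlgebra.lift C (step lam)).toLinearMap

theorem mixMul_one_left (lam : C) (t : TensorAlgebra C A) : mixMul lam 1 t = t := by
  simp [mixMul]

theorem mixMul_cons (lam : C) (a : A) (s : TensorAlgebra C A) :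
    mixMul lam (cons a s) = stepFun lam a (mixMul lam s) := by
  simp [mixMul, cons_apply, step]

theorem mixMul_one_right (lam : C) (s : TensorAlgebra C A) : mixMul lam s 1 = s := by
  induction s using word_induction with
  | one => exact mixMul_one_left lam 1
  | add s t hs ht => simp [hs, ht]
  | smul c t ht => simp [ht]
  | hcons a t ht => rw [mixMul_cons, stepFun_one, ht]

theorem mixMul_cons_cons (lam : C) (a b : A) (s t : TensorAlgebra C A) :
    mixMul lam (cons a s) (cons b t) =
      cons a (mixMul lam s (cons b t)) + cons b (mixMul lam (cons a s) t)
        + lam • cons (a * b) (mixMul lam s t) := by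
  rw [mixMul_cons, stepFun_cons]

theorem mixMul_comm (lam : C) (s t : TensorAlgebra C A) : mixMul lam s t = mixMul lam t s := by
  induction s using word_induction generalizing t with
  | one => rw [mixMul_one_left, mixMul_one_right]
  | add s s' hs hs' => simp [hs, hs']
  | smul c s hs => simp [hs]
  | hcons a s hs =>
    induction t using word_induction with
    | one => rw [mixMul_one_left, mixMul_one_right]
    | add t t' ht ht' => simp [ht, ht']
    | smul c t ht => simp [ht]
    | hcons b t ht =>
      rw [mixMul_cons_cons, mixMul_cons_cons, ht, hs, hs, mul_comm a b]
      abel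

theorem mixMul_assoc (lam : C) (s t u : TensorAlgebra C A) :
    mixMul lam (mixMul lam s t) u = mixMul lam s (mixMul lam t u) := by
  induction s using word_induction generalizing t u with
  | one => simp [mixMul_one_left]
  | add s s' hs hs' => simp [hs, hs']
  | smul c s hs => simp [hs]
  | hcons a s hs =>
    induction t using word_induction generalizing u with
    | one => simp [mixMul_one_left, mixMul_one_right]
    | add t t' ht ht' => simp [ht, ht']
    | smul c t ht => simp [ht]
    | hcons b t ht =>
      induction u using word_induction with
      | one => simp [mixMul_one_right]
      | add u u' hu hu' => simp [hu, hu']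
      | smul c u hu => simp [hu]
      | hcons c u hu =>
        have hu' := hu
        simp only [mixMul_cons_cons, map_add, map_smul, LinearMap.add_apply,
          LinearMap.smul_apply, smul_add, hs, ht, mul_assoc] at hu' ⊢
        have e : cons c (mixMul lam (cons a (mixMul lam s (cons b t))) u)
            + cons c (mixMul lam (cons b (mixMul lam (cons a s) t)) u)
            + lam • cons c (mixMul lam (cons (a * b) (mixMul lam s t)) u)
            = cons c (mixMul lam (cons a s) (mixMul lam (cons b t) u)) := by
          rw [← map_smul, ← map_add, ← map_add, hu']
        rw [← e, mul_left_comm a b c]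
        abel

end Product

/-- The `C`-module `T(A) = ⨁ₙ A^{⊗ n}` (Mathlib's tensor algebra, of which only the module
structure and the empty tensor `1` are kept), with the *mixable shuffle product* of weight `lam`:
the sum over all mixable shuffles `(σ, S)` of `x₁ ⊗ ⋯ ⊗ xₘ` and `y₁ ⊗ ⋯ ⊗ yₙ`, with coefficient
`lam ^ |S|`.  A mixable shuffle of `a ⊗ s` and `b ⊗ t` has first factor `a`, or `b`, or the merged
`ab` (weighted by `lam`), followed by a mixable shuffle of the remaining factors, so the product is
the bilinear one with unit `1` and
`(a ⊗ s) ⋆ (b ⊗ t) = a ⊗ (s ⋆ (b ⊗ t)) + b ⊗ ((a ⊗ s) ⋆ t) + lam (ab ⊗ (s ⋆ t))`;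
see `mixMul_one_left`, `mixMul_one_right`, `mixMul_cons_cons`. -/
def MixShuffle (C : Type*) [CommRing C] (_lam : C) (A : Type*) [CommRing A] [Algebra C A] :
    Type _ :=
  TensorAlgebra C A

section Sha

variable {C : Type*} [CommRing C] (lam : C) (A : Type*) [CommRing A] [Algebra C A]

instance : AddCommGroup (MixShuffle C lam A) := inferInstanceAs (AddCommGroup (TensorAlgebra C A))

instance : Module C (MixShuffle C lam A) := inferInstanceAs (Module C (TensorAlgebra C A))

instance : CommRing (MixShuffle C lam A) :=
  { (inferInstance : AddCommGroup (MixShuffle C lam A)) with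
    mul := fun s t => mixMul (C := C) (A := A) lam s t
    one := (1 : TensorAlgebra C A)
    left_distrib := fun s t u => map_add (mixMul (C := C) (A := A) lam s) t u
    right_distrib := fun s t u => LinearMap.map_add₂ (mixMul (C := C) (A := A) lam) s t u
    zero_mul := fun s => LinearMap.map_zero₂ (mixMul (C := C) (A := A) lam) s
    mul_zero := fun s => map_zero (mixMul (C := C) (A := A) lam s)
    mul_assoc := fun s t u => mixMul_assoc (C := C) (A := A) lam s t u
    one_mul := fun s => mixMul_one_left (C := C) (A := A) lam s
    mul_one := fun s => mixMul_one_right (C := C) (A := A) lam s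
    mul_comm := fun s t => mixMul_comm (C := C) (A := A) lam s t }

theorem MixShuffle.mul_def (s t : MixShuffle C lam A) :
    s * t = mixMul (C := C) (A := A) lam s t := rfl

instance : Algebra C (MixShuffle C lam A) :=
  Algebra.ofModule
    (fun r s t => LinearMap.map_smul₂ (mixMul (C := C) (A := A) lam) r s t)
    (fun r s t => map_smul (mixMul (C := C) (A := A) lam s) r t)

/-- The shuffle Baxter algebra `Ш_{C,lam}(A) = ⨁ₖ A^{⊗ (k+1)} = A ⊗ T(A)`, with the mixed shuffle
product `(x₀ ⊗ x⁺)(y₀ ⊗ y⁺) = x₀y₀ ⊗ (x⁺ ⋆ y⁺)`, where `⋆` is the mixable shuffle product of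
weight `lam`. -/
abbrev Sha : Type _ := A ⊗[C] MixShuffle C lam A

/-- Prepending a factor, as a map to `MixShuffle C lam A`. -/
def MixShuffle.cons : A →ₗ[C] MixShuffle C lam A →ₗ[C] MixShuffle C lam A :=
  ShuffleBaxter.cons (C := C) (A := A)

/-- The operator `P_A (x₀ ⊗ x₁ ⊗ ⋯ ⊗ xₙ) = 1 ⊗ x₀ ⊗ x₁ ⊗ ⋯ ⊗ xₙ` on `Ш_{C,lam}(A)`. -/
def shaOp : Sha lam A →ₗ[C] Sha lam A :=
  (TensorProduct.mk C A (MixShuffle C lam A) 1).comp (TensorProduct.lift (MixShuffle.cons lam A))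

variable {A}

/-- `P` is a Baxter operator of weight `lam`. -/
def IsBaxterOperator {R : Type*} [CommRing R] [Algebra C R] (P : R →ₗ[C] R) : Prop :=
  ∀ x y : R, P x * P y = P (x * P y) + P (y * P x) + lam • P (x * y)

theorem shaOp_tmul (a : A) (w : MixShuffle C lam A) :
    shaOp lam A (a ⊗ₜ w) = 1 ⊗ₜ MixShuffle.cons lam A a w := rfl

theorem MixShuffle.cons_mul_cons (a b : A) (s t : MixShuffle C lam A) :
    cons lam A a s * cons lam A b t =
      cons lam A a (s * cons lam A b t) + cons lam A b (t * cons lam A a s)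
        + lam • cons lam A (a * b) (s * t) := by
  rw [mul_comm t]
  exact mixMul_cons_cons lam a b s t

theorem MixShuffle.induction {p : MixShuffle C lam A → Prop} (one : p 1)
    (add : ∀ s t, p s → p t → p (s + t)) (smul : ∀ (c : C) t, p t → p (c • t))
    (hcons : ∀ a t, p t → p (cons lam A a t)) (t : MixShuffle C lam A) : p t :=
  word_induction (C := C) (A := A) one add smul hcons t

/-- `Ш_{C,lam}(A)` is a Baxter algebra of weight `lam`. -/
theorem isBaxterOperator_shaOp : IsBaxterOperator lam (shaOp lam A) := by
  intro x y
  induction x using TensorProduct.induction_on with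
  | zero => simp
  | add x x' hx hx' =>
    simp only [map_add, add_mul, mul_add, smul_add, hx, hx']; abel
  | tmul a s =>
    induction y using TensorProduct.induction_on with
    | zero => simp
    | add y y' hy hy' =>
      simp only [map_add, add_mul, mul_add, smul_add, hy, hy']; abel
    | tmul b t =>
      simp only [shaOp_tmul, Algebra.TensorProduct.tmul_mul_tmul, mul_one,
        MixShuffle.cons_mul_cons, TensorProduct.tmul_add, TensorProduct.tmul_smul]

/-- `Ш_{C,lam}(A)` is the free Baxter algebra of weight `lam` on `A`. -/
theorem sha_free {R : Type*} [CommRing R] [Algebra C R] (P : R →ₗ[C] R)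
    (hP : IsBaxterOperator lam P) (φ : A →ₐ[C] R) :
    ∃! f : Sha lam A →ₐ[C] R,
      (∀ x, f (shaOp lam A x) = P (f x)) ∧ ∀ a : A, f (a ⊗ₜ 1) = φ a := by
  let g : MixShuffle C lam A →ₗ[C] R :=
    (LinearMap.applyₗ (1 : R)).comp (TensorAlgebra.lift C
      ((LinearMap.llcomp C R R R P).comp ((LinearMap.mul C R).comp φ.toLinearMap))).toLinearMap
  have g_one : g 1 = 1 := by
    change (TensorAlgebra.lift C ((LinearMap.llcomp C R R R P).comp
      ((LinearMap.mul C R).comp φ.toLinearMap)) (1 : TensorAlgebra C A)) (1 : R) = 1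
    simp
  have g_cons (a : A) (t : MixShuffle C lam A) :
      g (MixShuffle.cons lam A a t) = P (φ a * g t) := by
    change (TensorAlgebra.lift C ((LinearMap.llcomp C R R R P).comp
      ((LinearMap.mul C R).comp φ.toLinearMap))
        (TensorAlgebra.ι C a * (show TensorAlgebra C A from t))) (1 : R) = _
    rw [map_mul, Module.End.mul_apply, TensorAlgebra.lift_ι_apply]
    rfl
  have g_mul (s t : MixShuffle C lam A) : g (s * t) = g s * g t := by
    induction s using MixShuffle.induction generalizing t with
    | one => rw [one_mul, g_one, one_mul]
    | add s s' hs hs' => rw [add_mul, map_add, map_add, add_mul, hs, hs']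
    | smul c s hs => rw [smul_mul_assoc, map_smul, map_smul, smul_mul_assoc, hs]
    | hcons a s hs =>
      induction t using MixShuffle.induction with
      | one => rw [mul_one, g_one, mul_one]
      | add t t' ht ht' => rw [mul_add, map_add, map_add, mul_add, ht, ht']
      | smul c t ht => rw [mul_smul_comm, map_smul, map_smul, mul_smul_comm, ht]
      | hcons b t ht =>
        have h1 : φ a * (g s * P (φ b * g t)) = φ a * g s * P (φ b * g t) := by ring
        have h2 : φ b * (P (φ a * g s) * g t) = φ b * g t * P (φ a * g s) := by ring
        have h3 : φ a * φ b * (g s * g t) = φ a * g s * (φ b * g t) := by ring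
        rw [MixShuffle.cons_mul_cons, mul_comm t, map_add, map_add, map_smul, g_cons, g_cons,
          g_cons, hs, hs, ht, g_cons, g_cons, map_mul φ, h1, h2, h3, hP]
  let G : MixShuffle C lam A →ₐ[C] R := AlgHom.ofLinearMap g g_one g_mul
  have G_cons (a : A) (t : MixShuffle C lam A) :
      G (MixShuffle.cons lam A a t) = P (φ a * G t) := g_cons a t
  refine ⟨Algebra.TensorProduct.lift φ G fun _ _ => Commute.all _ _, ⟨fun x => ?_, fun a => ?_⟩,
    fun f ⟨hf, hf'⟩ => ?_⟩
  · induction x using TensorProduct.induction_on with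
    | zero => simp
    | add x y hx hy => simp only [map_add, hx, hy]
    | tmul a t => simp [shaOp_tmul, G_cons]
  · simp
  · refine Algebra.TensorProduct.ext' fun a t => ?_
    have key : f (1 ⊗ₜ t) = G t := by
      induction t using MixShuffle.induction with
      | one => rw [map_one G, ← map_one f]; rfl
      | add s t hs ht => rw [TensorProduct.tmul_add, map_add, map_add, hs, ht]
      | smul c t ht => rw [TensorProduct.tmul_smul, map_smul, map_smul, ht]
      | hcons b t ht =>
        have : (b ⊗ₜ[C] t : Sha lam A) = (b ⊗ₜ 1) * (1 ⊗ₜ t) := by simp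
        rw [← shaOp_tmul, hf, this, map_mul, hf', ht, G_cons]
    have : (a ⊗ₜ[C] t : Sha lam A) = (a ⊗ₜ 1) * (1 ⊗ₜ t) := by simp
    rw [this, map_mul, hf', key, ← this]
    simp

end Sha

end

end ShuffleBaxter

/-! The zero-divisor question reduces to leading terms over a field. Let `E` be the fraction field
of `A`. Since `A` is flat, so is `T(A)`, hence `A ⊗ T(A)` embeds in `E ⊗ T(A)`, which in turn embeds
in `T_E(E ⊗ A)` compatibly with the mixable shuffle products (`baseChangeMap_injective`,
`wordMap_mixMul`).

Over `E` the module `E ⊗ A` has a basis. Order it linearly, and order words by length, then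
lexicographically. Merging letters shortens words, so in top length the product of two basis words
is their ordinary shuffle product, whatever the weight and the multiplication of `E ⊗ A`. Its
largest word is `maxShuffle u v`, with a positive integer coefficient, nonzero in characteristic
zero. As `maxShuffle` is strictly monotone, leading terms cannot cancel (`mixMul_ne_zero_of_basis`).

Conversely `A` is a subring of `Ш(A)`. Over a Dedekind domain flat and torsion-free coincide. -/

open Module

namespace ShuffleBaxter

/-! ### Combinatorics of the largest shuffle. -/

section LexShuffle

variable {I : Type*} [LinearOrder I]

/-- The lexicographically largest shuffle of two words. -/
def maxShuffle : List I → List I → List I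
  | [], v => v
  | a :: u, [] => a :: u
  | a :: u, b :: v => max (a :: maxShuffle u (b :: v)) (b :: maxShuffle (a :: u) v)
termination_by u v => u.length + v.length

theorem maxShuffle_nil_right (u : List I) : maxShuffle u [] = u := by
  cases u <;> simp [maxShuffle]

theorem maxShuffle_comm (u v : List I) : maxShuffle u v = maxShuffle v u := by
  induction u generalizing v with
  | nil => rw [maxShuffle_nil_right, maxShuffle]
  | cons a u hu =>
    induction v with
    | nil => rw [maxShuffle_nil_right, maxShuffle]
    | cons b v hv => rw [maxShuffle, maxShuffle, hu, hv, max_comm]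

theorem length_maxShuffle (u v : List I) : (maxShuffle u v).length = u.length + v.length := by
  induction u generalizing v with
  | nil => simp [maxShuffle]
  | cons a u hu =>
    induction v with
    | nil => simp [maxShuffle]
    | cons b v hv =>
      rw [maxShuffle]
      rcases max_choice (a :: maxShuffle u (b :: v)) (b :: maxShuffle (a :: u) v) with h | h <;>
        rw [h] <;> simp [hu, hv] <;> omega

/-- Both candidates in the recursive maximum strictly increase. Equal lengths exclude comparisons
where one word is a proper prefix of the other. -/
theorem maxShuffle_lt_left {u u' : List I} (hl : u.length = u'.length) (h : u < u')
    (v : List I) : maxShuffle u v < maxShuffle u' v := by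
  induction u generalizing u' v with
  | nil =>
    cases u' with
    | nil => exact absurd h (lt_irrefl _)
    | cons a' u' => simp at hl
  | cons a u hu =>
    cases u' with
    | nil => simp at hl
    | cons a' u' =>
      have hl' : u.length = u'.length := by simpa using hl
      induction v with
      | nil => simpa [maxShuffle_nil_right] using h
      | cons b v hv =>
        rw [maxShuffle, maxShuffle]
        refine max_lt_max ?_ (List.cons_lt_cons_iff.2 (Or.inr ⟨rfl, hv⟩))
        rcases List.cons_lt_cons_iff.1 h with h1 | ⟨rfl, h1⟩
        · exact List.cons_lt_cons_iff.2 (Or.inl h1)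
        · exact List.cons_lt_cons_iff.2 (Or.inr ⟨rfl, hu hl' h1 _⟩)

/-- The key ordering words by length, then lexicographically. -/
def wordKey (w : List I) : ℕ ×ₗ List I := toLex (w.length, w)

omit [LinearOrder I] in
theorem wordKey_injective : Function.Injective (wordKey : List I → _) := fun _ _ h =>
  congrArg (fun p => (ofLex p).2) h

theorem wordKey_maxShuffle_lt_left {u u' : List I} (h : wordKey u < wordKey u') (v : List I) :
    wordKey (maxShuffle u v) < wordKey (maxShuffle u' v) := by
  simp only [wordKey, Prod.Lex.toLex_lt_toLex, length_maxShuffle] at h ⊢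
  rcases h with h | ⟨hl, h⟩
  · left; omega
  · exact Or.inr ⟨by omega, maxShuffle_lt_left hl h v⟩

theorem wordKey_maxShuffle_le_left {u u' : List I} (h : wordKey u ≤ wordKey u') (v : List I) :
    wordKey (maxShuffle u v) ≤ wordKey (maxShuffle u' v) := by
  rcases h.eq_or_lt with h | h
  · rw [wordKey_injective h]
  · exact (wordKey_maxShuffle_lt_left h v).le

/-- This makes the leading pair unique: no other pair of words from the two supports can reach the
top word. -/
theorem wordKey_maxShuffle_lt {u u' v v' : List I} (hu : wordKey u ≤ wordKey u')
    (hv : wordKey v ≤ wordKey v') (h : u ≠ u' ∨ v ≠ v') :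
    wordKey (maxShuffle u v) < wordKey (maxShuffle u' v') := by
  rcases h with h | h
  · refine (wordKey_maxShuffle_lt_left (hu.lt_of_ne (wordKey_injective.ne h)) v).trans_le ?_
    rw [maxShuffle_comm u' v, maxShuffle_comm u' v']
    exact wordKey_maxShuffle_le_left hv u'
  · refine (wordKey_maxShuffle_le_left hu v).trans_lt ?_
    rw [maxShuffle_comm u' v, maxShuffle_comm u' v']
    exact wordKey_maxShuffle_lt_left (hv.lt_of_ne (wordKey_injective.ne h)) u'

end LexShuffle

/-! ### Leading words of mixable shuffle products over a free module. -/

section WordBasis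

variable {F : Type*} [CommRing F] {B : Type*} [CommRing B] [Algebra F B] {I : Type*}

/-- The basis of the tensor algebra consisting of the words in a basis. -/
noncomputable def wordBasis (b : Basis I F B) : Basis (List I) F (TensorAlgebra F B) :=
  b.tensorAlgebra.reindex FreeMonoid.toList

theorem wordBasis_nil (b : Basis I F B) : wordBasis b [] = 1 := by
  simp [wordBasis, Basis.tensorAlgebra, FreeAlgebra.basisFreeMonoid,
    FreeAlgebra.equivMonoidAlgebraFreeMonoid]

theorem wordBasis_cons (b : Basis I F B) (i : I) (w : List I) :
    wordBasis b (i :: w) = cons (b i) (wordBasis b w) := by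
  simp [wordBasis, Basis.tensorAlgebra, FreeAlgebra.basisFreeMonoid,
    FreeAlgebra.equivMonoidAlgebraFreeMonoid, cons_apply]

theorem wordBasis_repr_cons_nil (b : Basis I F B) (x : B) (t : TensorAlgebra F B) :
    (wordBasis b).repr (cons x t) [] = 0 := by
  have : (cons (C := F) (A := B)).compr₂ ((wordBasis b).coord []) = 0 := by
    refine b.ext fun i => (wordBasis b).ext fun w => ?_
    simp [← wordBasis_cons]
  exact congr($this x t)

theorem wordBasis_repr_cons_cons (b : Basis I F B) (x : B) (t : TensorAlgebra F B) (j : I)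
    (w : List I) :
    (wordBasis b).repr (cons x t) (j :: w) = b.repr x j * (wordBasis b).repr t w := by
  have : (cons (C := F) (A := B)).compr₂ ((wordBasis b).coord (j :: w)) =
      (LinearMap.mul F F).compl₁₂ (b.coord j) ((wordBasis b).coord w) := by
    classical
    refine b.ext fun i => (wordBasis b).ext fun v => ?_
    simp [← wordBasis_cons, Finsupp.single_apply, ← ite_and, and_comm]
  exact congr($this x t)

/-- A shuffle preserves total length and a merge lowers it, so no longer word occurs. -/
theorem repr_mixMul_eq_zero_of_length_lt (lam : F) (b : Basis I F B) {u v w : List I}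
    (h : u.length + v.length < w.length) :
    (wordBasis b).repr (mixMul lam (wordBasis b u) (wordBasis b v)) w = 0 := by
  induction u generalizing v w with
  | nil =>
    have : v ≠ w := by rintro rfl; simp at h
    simp [wordBasis_nil, mixMul_one_left, this]
  | cons a u hu =>
    induction v generalizing w with
    | nil =>
      have : a :: u ≠ w := by rintro rfl; simp at h
      rw [wordBasis_nil, mixMul_one_right]
      simp [this]
    | cons c v hv =>
      cases w with
      | nil => simp at h
      | cons j w =>
        simp only [List.length_cons] at h hv
        have h1 := hu (v := c :: v) (w := w) (by simp; omega)
        have h2 := hv (w := w) (by omega)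
        have h3 := hu (v := v) (w := w) (by omega)
        rw [wordBasis_cons] at h1 h2
        rw [wordBasis_cons, wordBasis_cons, mixMul_cons_cons]
        simp only [map_add, map_smul, Finsupp.add_apply, Finsupp.smul_apply,
          wordBasis_repr_cons_cons, h1, h2, h3]
        simp

/-- In top length the coefficient counts ordinary shuffles producing `w`. Keeping it in `ℕ` rules
out cancellation between the two branches of the recursion. -/
theorem exists_nat_repr_mixMul [LinearOrder I] (lam : F) (b : Basis I F B) {u v w : List I}
    (h : w.length = u.length + v.length) :
    ∃ n : ℕ, (wordBasis b).repr (mixMul lam (wordBasis b u) (wordBasis b v)) w = n ∧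
      (maxShuffle u v < w → n = 0) ∧ (w = maxShuffle u v → 0 < n) := by
  induction u generalizing v w with
  | nil =>
    refine ⟨if v = w then 1 else 0, ?_, ?_, ?_⟩
    · simp [wordBasis_nil, mixMul_one_left, Finsupp.single_apply]
    · simp only [maxShuffle]
      intro h
      simp [h.ne]
    · rintro rfl
      simp [maxShuffle]
  | cons a u hu =>
    induction v generalizing w with
    | nil =>
      refine ⟨if a :: u = w then 1 else 0, ?_, ?_, ?_⟩
      · rw [wordBasis_nil, mixMul_one_right]
        simp [Finsupp.single_apply]
      · simp only [maxShuffle]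
        intro h
        simp [h.ne]
      · rintro rfl
        simp [maxShuffle]
    | cons c v hv =>
      cases w with
      | nil => simp at h
      | cons j w =>
        simp only [List.length_cons] at h hv
        obtain ⟨n, h1, hn, hn'⟩ := hu (v := c :: v) (w := w) (by simp; omega)
        obtain ⟨m, h2, hm, hm'⟩ := hv (w := w) (by omega)
        -- The tail `w` has length `|u| + |v| + 1`, one too long for the merged term, so the weight
        -- drops out.
        have h3 := repr_mixMul_eq_zero_of_length_lt lam b (u := u) (v := v) (w := w) (by omega)
        rw [wordBasis_cons] at h1 h2
        refine ⟨(if a = j then n else 0) + (if c = j then m else 0), ?_, ?_, ?_⟩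
        · rw [wordBasis_cons, wordBasis_cons, mixMul_cons_cons]
          simp only [map_add, map_smul, Finsupp.add_apply, Finsupp.smul_apply,
            wordBasis_repr_cons_cons, h1, h2, h3, Basis.repr_self, Finsupp.single_apply]
          simp
        · rw [maxShuffle, max_lt_iff]
          rintro ⟨hl, hr⟩
          rw [List.cons_lt_cons_iff] at hl hr
          rw [Nat.add_eq_zero_iff]
          constructor
          · split_ifs with e
            · subst e; exact hn (by simpa using hl)
            · rfl
          · split_ifs with e
            · subst e; exact hm (by simpa using hr)
            · rfl
        · rw [maxShuffle]
          intro e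
          rcases max_choice (a :: maxShuffle u (c :: v)) (c :: maxShuffle (a :: u) v) with h' | h'
            <;> rw [h', List.cons.injEq] at e <;> obtain ⟨rfl, e⟩ := e
          · have := hn' e
            simp only [if_true]; omega
          · have := hm' e
            simp only [if_true]; omega

theorem wordKey_le_of_repr_mixMul_ne_zero [LinearOrder I] (lam : F) (b : Basis I F B)
    {u v w : List I}
    (h : (wordBasis b).repr (mixMul lam (wordBasis b u) (wordBasis b v)) w ≠ 0) :
    wordKey w ≤ wordKey (maxShuffle u v) := by
  simp only [wordKey, Prod.Lex.toLex_le_toLex, length_maxShuffle]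
  rcases lt_trichotomy w.length (u.length + v.length) with hl | hl | hl
  · exact Or.inl hl
  · refine Or.inr ⟨hl, le_of_not_gt fun hlt => h ?_⟩
    obtain ⟨n, hn, h0, -⟩ := exists_nat_repr_mixMul lam b hl
    rw [hn, h0 hlt, Nat.cast_zero]
  · exact absurd (repr_mixMul_eq_zero_of_length_lt lam b hl) h

theorem repr_mixMul_maxShuffle_ne_zero [CharZero F] [LinearOrder I] (lam : F) (b : Basis I F B)
    (u v : List I) :
    (wordBasis b).repr (mixMul lam (wordBasis b u) (wordBasis b v)) (maxShuffle u v) ≠ 0 := by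
  obtain ⟨n, hn, -, hpos⟩ := exists_nat_repr_mixMul lam b (length_maxShuffle u v)
  rw [hn]
  exact Nat.cast_ne_zero.2 (hpos rfl).ne'

theorem exists_leading_word [LinearOrder I] (b : Basis I F B) {s : TensorAlgebra F B}
    (hs : s ≠ 0) : ∃ u, (wordBasis b).repr s u ≠ 0 ∧
      ∀ u', (wordBasis b).repr s u' ≠ 0 → wordKey u' ≤ wordKey u := by
  have hne : ((wordBasis b).repr s).support.Nonempty := by
    simpa [Finsupp.support_nonempty_iff] using hs
  obtain ⟨u, hu, hmax⟩ := Finset.exists_max_image _ wordKey hne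
  exact ⟨u, by simpa using hu, fun u' hu' => hmax u' (by simpa using hu')⟩

/-- With `u`, `v` the leading words, the coefficient at `maxShuffle u v` is a product of three
nonzero scalars. -/
theorem mixMul_ne_zero_of_basis [IsDomain F] [CharZero F] [LinearOrder I] (lam : F)
    (b : Basis I F B) {s t : TensorAlgebra F B} (hs : s ≠ 0) (ht : t ≠ 0) :
    mixMul lam s t ≠ 0 := by
  obtain ⟨u, hu, hu'⟩ := exists_leading_word b hs
  obtain ⟨v, hv, hv'⟩ := exists_leading_word b ht
  intro h0
  have key : (wordBasis b).repr (mixMul lam s t) (maxShuffle u v) =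
      (wordBasis b).repr s u * ((wordBasis b).repr t v *
        (wordBasis b).repr (mixMul lam (wordBasis b u) (wordBasis b v)) (maxShuffle u v)) := by
    have expand : (wordBasis b).repr (mixMul lam s t) (maxShuffle u v) =
        ∑ x ∈ ((wordBasis b).repr s).support, ∑ y ∈ ((wordBasis b).repr t).support,
          (wordBasis b).repr s x * ((wordBasis b).repr t y *
            (wordBasis b).repr (mixMul lam (wordBasis b x) (wordBasis b y)) (maxShuffle u v)) := by
      conv_lhs => rw [← (wordBasis b).linearCombination_repr s,
        ← (wordBasis b).linearCombination_repr t]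
      simp only [Finsupp.linearCombination_apply, Finsupp.sum, map_sum, LinearMap.sum_apply,
        Finsupp.finsetSum_apply, map_smul, LinearMap.smul_apply, Finsupp.smul_apply, smul_eq_mul,
        Finset.mul_sum]
      rw [Finset.sum_comm]
      exact Finset.sum_congr rfl fun x _ => Finset.sum_congr rfl fun y _ => mul_left_comm _ _ _
    have vanish {x y : List I} (hx : (wordBasis b).repr s x ≠ 0)
        (hy : (wordBasis b).repr t y ≠ 0) (hne : x ≠ u ∨ y ≠ v) :
        (wordBasis b).repr (mixMul lam (wordBasis b x) (wordBasis b y)) (maxShuffle u v) = 0 := by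
      by_contra hc
      exact (wordKey_le_of_repr_mixMul_ne_zero lam b hc).not_gt
        (wordKey_maxShuffle_lt (hu' x hx) (hv' y hy) hne)
    rw [expand, Finset.sum_eq_single u, Finset.sum_eq_single v]
    · intro y hy hne
      rw [vanish hu (by simpa using hy) (Or.inr hne), mul_zero, mul_zero]
    · intro h; exact absurd (by simpa using hv) h
    · intro x hx hne
      refine Finset.sum_eq_zero fun y hy => ?_
      rw [vanish (by simpa using hx) (by simpa using hy) (Or.inl hne), mul_zero, mul_zero]
    · intro h; exact absurd (by simpa using hu) h
  rw [h0] at key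
  have := repr_mixMul_maxShuffle_ne_zero lam b u v
  simp_all

/-- The mixable shuffle product over a domain of characteristic zero has no zero divisors on a
free module. -/
instance MixShuffle.noZeroDivisors [IsDomain F] [CharZero F] [Module.Free F B] (lam : F) :
    NoZeroDivisors (MixShuffle F lam B) where
  eq_zero_or_eq_zero_of_mul_eq_zero {s t} h := by
    obtain ⟨⟨I, b⟩⟩ := Module.Free.exists_basis (R := F) (M := B)
    classical
    -- Any linear order on the index set would do.
    let _ : LinearOrder I := linearOrderOfSTO WellOrderingRel
    by_contra! hne
    exact mixMul_ne_zero_of_basis lam b hne.1 hne.2 h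

end WordBasis

/-! ### Extension of scalars. -/

section BaseChange

variable {C : Type*} [CommRing C] {A : Type*} [CommRing A] [Algebra C A]
  (E : Type*) [CommRing E] [Algebra C E]

/-- The map `T_C(A) → T_E(E ⊗ A)` induced by `a ↦ 1 ⊗ a`. -/
noncomputable def wordMap : TensorAlgebra C A →ₐ[C] TensorAlgebra E (E ⊗[C] A) :=
  TensorAlgebra.lift C
    (((TensorAlgebra.ι E).restrictScalars C).comp (TensorProduct.mk C E A 1))

theorem wordMap_cons (a : A) (t : TensorAlgebra C A) :
    wordMap E (cons a t) = cons (C := E) (1 ⊗ₜ[C] a : E ⊗[C] A) (wordMap E t) := by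
  simp [wordMap, cons_apply]

theorem wordMap_smul (c : C) (t : TensorAlgebra C A) :
    wordMap E (c • t) = algebraMap C E c • wordMap E t := by
  rw [map_smul, algebraMap_smul]

/-- The recursion is preserved because `a ↦ 1 ⊗ a` is multiplicative, which matters only for the
merged term. -/
theorem wordMap_mixMul (lam : C) (s t : TensorAlgebra C A) :
    wordMap E (mixMul lam s t) = mixMul (algebraMap C E lam) (wordMap E s) (wordMap E t) := by
  induction s using word_induction generalizing t with
  | one => rw [mixMul_one_left, map_one, mixMul_one_left]
  | add s s' hs hs' => simp only [map_add, LinearMap.add_apply, hs, hs']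
  | smul c s hs =>
    simp only [wordMap_smul, map_smul (mixMul _), LinearMap.smul_apply, hs]
  | hcons a s hs =>
    induction t using word_induction with
    | one => rw [mixMul_one_right, map_one, mixMul_one_right]
    | add t t' ht ht' => simp only [map_add, ht, ht']
    | smul c t ht => rw [map_smul, wordMap_smul, wordMap_smul, map_smul, ht]
    | hcons b t ht =>
      rw [mixMul_cons_cons, map_add, map_add, wordMap_smul, wordMap_cons, wordMap_cons,
        wordMap_cons, hs, hs, ht, wordMap_cons, wordMap_cons, mixMul_cons_cons,
        Algebra.TensorProduct.tmul_mul_tmul, one_mul]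

/-- The base change map `E ⊗ T_C(A) → T_E(E ⊗ A)`. -/
noncomputable def baseChangeMap :
    E ⊗[C] TensorAlgebra C A →ₐ[E] TensorAlgebra E (E ⊗[C] A) :=
  Algebra.TensorProduct.lift (Algebra.ofId E _) (wordMap E)
    fun r _ => by rw [Algebra.ofId_apply]; exact Algebra.commute_algebraMap_left r _

theorem baseChangeMap_tmul (r : E) (t : TensorAlgebra C A) :
    baseChangeMap E (r ⊗ₜ t) = r • wordMap E t := by
  rw [baseChangeMap, Algebra.TensorProduct.lift_tmul, Algebra.ofId_apply, Algebra.smul_def]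

/-- The base change of `ι` induces a left inverse; for the concatenation product it suffices to
check this on generators. -/
theorem baseChangeMap_injective :
    Function.Injective (baseChangeMap E : E ⊗[C] TensorAlgebra C A →ₐ[E] _) := by
  let g : TensorAlgebra E (E ⊗[C] A) →ₐ[E] E ⊗[C] TensorAlgebra C A :=
    TensorAlgebra.lift E ((TensorAlgebra.ι C).baseChange E)
  have h : g.comp (baseChangeMap E) = AlgHom.id E _ := by
    ext a
    simp [g, baseChangeMap_tmul, wordMap]
  exact Function.LeftInverse.injective (g := g) fun x => congr($h x)

theorem noZeroDivisors_baseChange [IsDomain E] [CharZero E] [Module.Free E (E ⊗[C] A)]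
    (lam : C) : NoZeroDivisors (E ⊗[C] MixShuffle C lam A) := by
  -- `baseChangeMap` is multiplicative for concatenation; here only its additivity and injectivity
  -- are kept, and compatibility with the shuffle product is proved separately.
  let f : E ⊗[C] MixShuffle C lam A → MixShuffle E (algebraMap C E lam) (E ⊗[C] A) :=
    fun x => baseChangeMap (C := C) (A := A) E x
  have f_add (x y) : f (x + y) = f x + f y := map_add (baseChangeMap (C := C) (A := A) E) x y
  have f_zero : f 0 = 0 := map_zero (baseChangeMap (C := C) (A := A) E)
  have f_tmul (r : E) (s : MixShuffle C lam A) : f (r ⊗ₜ s) = r • wordMap (C := C) (A := A) E s :=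
    baseChangeMap_tmul (C := C) (A := A) E r s
  have f_mul (r q : E) (s t : TensorAlgebra C A) :
      (r * q) • wordMap E (mixMul lam s t) =
        mixMul (algebraMap C E lam) (r • wordMap E s) (q • wordMap E t) := by
    rw [wordMap_mixMul, map_smul, map_smul, LinearMap.smul_apply, smul_smul, mul_comm]
  refine Function.Injective.noZeroDivisors f (baseChangeMap_injective E) f_zero fun x y => ?_
  induction x using TensorProduct.induction_on with
  | zero => rw [zero_mul, f_zero, zero_mul]
  | add x x' hx hx' => rw [add_mul, f_add, f_add, add_mul, hx, hx']
  | tmul r s =>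
    induction y using TensorProduct.induction_on with
    | zero => rw [mul_zero, f_zero, mul_zero]
    | add y y' hy hy' => rw [mul_add, f_add, f_add, mul_add, hy, hy']
    | tmul q t =>
      rw [Algebra.TensorProduct.tmul_mul_tmul, f_tmul, f_tmul, f_tmul]
      exact f_mul r q s t

end BaseChange

/-! ### Flatness of the tensor algebra. -/

section Flat

variable {C : Type*} [CommRing C]

theorem flat_tensorPower (M : Type*) [AddCommGroup M] [Module C M] [Module.Flat C M] (n : ℕ) :
    Module.Flat C (⨂[C]^n M) := by
  induction n with
  | zero => exact Module.Flat.of_linearEquiv TensorPower.algebraMap₀.symm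
  | succ n ih =>
    have : Module.Flat C (⨂[C]^1 M) :=
      Module.Flat.of_linearEquiv (PiTensorProduct.subsingletonEquiv (s := fun _ : Fin 1 => M) 0)
    exact Module.Flat.of_linearEquiv (TensorPower.mulEquiv (n := n) (m := 1)).symm

instance flat_tensorAlgebra (M : Type*) [AddCommGroup M] [Module C M] [Module.Flat C M] :
    Module.Flat C (TensorAlgebra C M) :=
  have := flat_tensorPower (C := C) M
  Module.Flat.of_linearEquiv TensorAlgebra.equivDirectSum.toLinearEquiv

end Flat

/-! ### Passage between `A` and `Ш(A)`. -/

section Domain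

variable {C : Type*} [CommRing C] (lam : C) (A : Type*) [CommRing A] [Algebra C A]

theorem sha_includeLeft_injective :
    Function.Injective (Algebra.TensorProduct.includeLeft : A →ₐ[C] Sha lam A) := by
  -- Projection onto the empty-word component, giving a linear retraction of `a ↦ a ⊗ 1`.
  let p : MixShuffle C lam A →ₗ[C] C :=
    (TensorAlgebra.algebraMapInv : TensorAlgebra C A →ₐ[C] C).toLinearMap
  have hp : p 1 = 1 := map_one (TensorAlgebra.algebraMapInv : TensorAlgebra C A →ₐ[C] C)
  refine Function.LeftInverse.injective
    (g := fun x => TensorProduct.rid C A (LinearMap.lTensor A p x)) fun a => ?_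
  simp [hp]

theorem isDomain_sha_of_flat [IsDomain C] [CharZero C] [IsDomain A] [Module.Flat C A] :
    IsDomain (Sha lam A) := by
  have hCA : Function.Injective (algebraMap C A) := FaithfulSMul.algebraMap_injective C A
  have : Nontrivial (Sha lam A) := (sha_includeLeft_injective lam A).nontrivial
  have hA : Function.Injective (algebraMap A (FractionRing A)) :=
    IsFractionRing.injective A (FractionRing A)
  have hCE : Function.Injective (algebraMap C (FractionRing A)) := by
    rw [IsScalarTower.algebraMap_eq C A (FractionRing A)]
    exact hA.comp hCA
  have : CharZero (FractionRing A) := charZero_of_injective_algebraMap hCE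
  -- Freeness of `FractionRing A ⊗ A` is automatic over a field; this tensor product need not be a
  -- domain.
  have := noZeroDivisors_baseChange (A := A) (FractionRing A) lam
  have : Module.Flat C (MixShuffle C lam A) := flat_tensorAlgebra (C := C) A
  let f : Sha lam A →ₐ[C] FractionRing A ⊗[C] MixShuffle C lam A :=
    Algebra.TensorProduct.map (IsScalarTower.toAlgHom C A (FractionRing A)) (AlgHom.id C _)
  have hf : Function.Injective f :=
    Module.Flat.rTensor_preserves_injective_linearMap (M := MixShuffle C lam A)
      (IsScalarTower.toAlgHom C A (FractionRing A)).toLinearMap hA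
  have := hf.noZeroDivisors f (map_zero f) (map_mul f)
  exact NoZeroDivisors.to_isDomain _

theorem isDomain_of_isDomain_sha [IsDomain (Sha lam A)] : IsDomain A :=
  (sha_includeLeft_injective lam A).isDomain
    (Algebra.TensorProduct.includeLeft : A →ₐ[C] Sha lam A).toRingHom

end Domain

end ShuffleBaxter

theorem mainTheorem5 {C : Type*} [CommRing C] [IsDomain C] [CharZero C] (lam : C) :
    (∀ (A : Type*) [CommRing A] [IsDomain A] [Algebra C A], Module.Flat C A →
        IsDomain (ShuffleBaxter.Sha lam A)) ∧
    (∀ X : Type*, IsDomain (ShuffleBaxter.Sha lam (MvPolynomial X C))) ∧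
    (IsDedekindDomain C → ∀ (A : Type*) [CommRing A] [Algebra C A],
        Function.Injective (algebraMap C A) →
          (IsDomain (ShuffleBaxter.Sha lam A) ↔ IsDomain A ∧ Module.IsTorsionFree C A)) := by
  refine ⟨fun A _ _ _ _ => ShuffleBaxter.isDomain_sha_of_flat lam A,
    fun X => ShuffleBaxter.isDomain_sha_of_flat lam _, fun _ A _ _ hinj => ⟨fun _ => ?_, ?_⟩⟩
  · have hA := ShuffleBaxter.isDomain_of_isDomain_sha lam A
    have : FaithfulSMul C A := (faithfulSMul_iff_algebraMap_injective C A).2 hinj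
    exact ⟨hA, inferInstance⟩
  · rintro ⟨_, _⟩
    -- Torsion-free modules over a Dedekind domain are flat.
    exact ShuffleBaxter.isDomain_sha_of_flat lam A
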